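/- Let $\mathcal H$ be a complex Hilbert space with scalar product $(\cdot|\cdot)$ (antilinear in the first argument), $h$ a selfadjoint (possibly unbounded, not necessarily semibounded) operator on $\mathcal H$, and $\langle h\rangle=(1+h^2)^{1/2}$. For $s\ge 0$ let $\langle h\rangle^{-s}\mathcal H=\mathrm{Dom}\,|h|^s$ with norm $\|\langle h\rangle^s u\|$, and let $\langle h\rangle^{s}\mathcal H=(\langle h\rangle^{-s}\mathcal H)^*$ be the space of continuous antilinear functionals on it; for $u\in\langle h\rangle^{-s}\mathcal H$, $\varphi\in\langle h\rangle^{s}\mathcal H$ write $(u|\varphi)=\varphi(u)$, $(\varphi|u)=\overline{\varphi(u)}$. We identify $v\in\mathcal H$ with the functional $(\cdot|v)$, so that $\langle h\rangle^{-s}\mathcal H\subset\langle h\rangle^{-t}\mathcal H\subset\mathcal H\subset\langle h\rangle^{t}\mathcal H\subset\langle h\rangle^{s}\mathcal H$ for $0\le t\le s$. The operator $h$ extends uniquely to a continuous map $h:\langle h\rangle^{-1/2}\mathcal H\to\langle h\rangle^{1/2}\mathcal H$. Assume: (A1) $k:\langle h\rangle^{-1/2}\mathcal H\to\mathcal H$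 is bounded and symmetric, i.e. $(ku|v)=(u|kv)$ for $u,v\in\langle h\rangle^{-1/2}\mathcal H$. Its unique continuous extension $\mathcal H\to\langle h\rangle^{1/2}\mathcal H$, given by $v\mapsto (k\,\cdot\,|v)$, is again denoted by $k$. Put $h_0=h+k^2:\langle h\rangle^{-1/2}\mathcal H\to\langle h\rangle^{1/2}\mathcal H$, $p(z)=h+z(2k-z):\langle h\rangle^{-1/2}\mathcal H\to\langle h\rangle^{1/2}\mathcal H$ for $z\in\mathbb C$, and $$\rho(h,k)=\{z\in\mathbb C:\ p(z):\langle h\rangle^{-1/2}\mathcal H\to\langle h\rangle^{1/2}\mathcal H\ \text{is bijective}\}.$$ (A2) $\rho(h,k)\neq\emptyset$. Let $\mathcal E=\langle h\rangle^{-1/2}\mathcal H\oplus\mathcal H$, $\mathcal E^*=\mathcal H\oplus\langle h\rangle^{1/2}\mathcal H$ and $$\hat K=\begin{pmatrix}k&1\\h_0&k\end{pmatrix}:\mathcal E\to\mathcal E^*,\qquad \hat K\begin{pmatrix}u_0\\u_1\end{pmatrix}=\begin{pmatrix}ku_0+u_1\\h_0u_0+ku_1\end{pmatrix}.$$ For $0\le\theta\le\frac12$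 let $\mathcal K_\theta=\langle h\rangle^{-\theta}\mathcal H\oplus\langle h\rangle^{\theta}\mathcal H$, so $\mathcal E\subset\mathcal K_\theta\subset\mathcal E^*$, with the hermitian form $\langle u|v\rangle=(u_0|v_1)+(u_1|v_0)$. Let $K_\theta$ be the operator induced by $\hat K$ in $\mathcal K_\theta$, i.e. the restriction of $\hat K$ to $\{u\in\mathcal E:\hat Ku\in\mathcal K_\theta\}$, viewed as an operator in $\mathcal K_\theta$. Then: 1. $\displaystyle \mathrm{Dom}\,K_\theta=\Big\{\begin{pmatrix}u_0\\u_1\end{pmatrix}:\ u_0\in\langle h\rangle^{-1/2}\mathcal H,\ u_1\in\mathcal H,\ ku_0+u_1\in\langle h\rangle^{-\theta}\mathcal H,\ h_0u_0+ku_1\in\langle h\rangle^{\theta}\mathcal H\Big\}.$ 2. $(\mathcal K_\theta,\langle\cdot|\cdot\rangle)$ is a Krein space (a Hilbertizable Banach space with a continuous hermitian form by which every continuous linear form $\varphi$ is represented as $\varphi=\langle u|\cdot\rangle$ with a unique $u$), and $K_\theta$ is selfadjoint on it: $K_\theta$ is densely defined and equals its adjoint with respect to $\langle\cdot|\cdot\rangle$.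 3. $\rho(K_\theta)=\rho(h,k)$, where $\rho(K_\theta)$ is the set of $z\in\mathbb C$ for which $K_\theta-z:\mathrm{Dom}\,K_\theta\to\mathcal K_\theta$ is bijective with bounded inverse. -/

import Mathlib

open scoped NNReal InnerProductSpace ComplexConjugate

noncomputable section

namespace KleinGordon

variable {H : Type*} [NormedAddCommGroup H] [InnerProductSpace ℂ H] [CompleteSpace H]
  {h : H →ₗ.[ℂ] H}

lemma inner_symm (hh : IsSelfAdjoint h) (u v : h.domain) :
    ⟪h u, (v : H)⟫_ℂ = ⟪(u : H), h v⟫_ℂ := by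
  have := LinearPMap.adjoint_isFormalAdjoint hh.dense_domain
  rw [(LinearPMap.isSelfAdjoint_def).mp hh] at this
  exact this u v

lemma mem_graph_of_forall (hh : IsSelfAdjoint h) (v w : H)
    (hw : ∀ u : h.domain, ⟪w, (u : H)⟫_ℂ = ⟪v, h u⟫_ℂ) : (v, w) ∈ h.graph := by
  have hd := hh.dense_domain
  have hv := LinearPMap.mem_adjoint_domain_of_exists (T := h) v ⟨w, hw⟩
  have h2 := LinearPMap.adjoint_apply_eq hd (⟨v, hv⟩ : h.adjoint.domain) hw
  have h3 : (v, w) ∈ h.adjoint.graph := by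
    rw [LinearPMap.mem_graph_iff]; exact ⟨⟨v, hv⟩, rfl, h2⟩
  rwa [(LinearPMap.isSelfAdjoint_def).mp hh] at h3

/-- Solving `(1 + h²) u = f`; here `w = h u`. -/
lemma exists_solution (hh : IsSelfAdjoint h) :
    ∃ R : H →L[ℂ] H, ∀ f : H, ∃ w : H, (R f, w) ∈ h.graph ∧ (w, f - R f) ∈ h.graph := by
  let V : Submodule ℂ (WithLp 2 (H × H)) :=
    h.graph.comap (WithLp.linearEquiv 2 ℂ (H × H)).toLinearMap
  have hVc : IsClosed (V : Set (WithLp 2 (H × H))) := by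
    have : Continuous (fun x : WithLp 2 (H × H) => ((x.fst, x.snd) : H × H)) := by fun_prop
    exact (hh.isClosed : IsClosed (h.graph : Set (H × H))).preimage this
  have : CompleteSpace V := hVc.completeSpace_coe
  let ι : V →L[ℂ] H := (WithLp.fstL 2 ℂ H H).comp V.subtypeL
  refine ⟨ι.comp (ContinuousLinearMap.adjoint ι), fun f => ?_⟩
  set p := ContinuousLinearMap.adjoint ι f with hp
  refine ⟨(p : WithLp 2 (H × H)).snd, p.2, ?_⟩
  apply mem_graph_of_forall hh
  intro u
  let q : V := ⟨WithLp.toLp 2 ((u : H), h u), by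
    show ((u : H), h u) ∈ h.graph
    exact h.mem_graph u⟩
  have h1 : ⟪p, q⟫_ℂ = ⟪f, ι q⟫_ℂ := ContinuousLinearMap.adjoint_inner_left ι q f
  have h2 : ⟪p, q⟫_ℂ = ⟪(p : WithLp 2 (H × H)).fst, (u : H)⟫_ℂ
      + ⟪(p : WithLp 2 (H × H)).snd, h u⟫_ℂ := by
    rw [Submodule.coe_inner, WithLp.prod_inner_apply]; rfl
  have h3 : ι q = (u : H) := rfl
  have h4 : (ι.comp (ContinuousLinearMap.adjoint ι)) f = (p : WithLp 2 (H × H)).fst := rfl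
  rw [h4, inner_sub_left, ← h3, ← h1, h2, h3]; ring

/-- `⟨h⟩⁻² = (1 + h²)⁻¹`, the bounded operator with `f = R f + h (h (R f))` for all `f`. -/
def japInvSq (hh : IsSelfAdjoint h) : H →L[ℂ] H := (exists_solution hh).choose

lemma japInvSq_spec (hh : IsSelfAdjoint h) (f : H) :
    ∃ w : H, (japInvSq hh f, w) ∈ h.graph ∧ (w, f - japInvSq hh f) ∈ h.graph :=
  (exists_solution hh).choose_spec f

lemma graph_symm (hh : IsSelfAdjoint h) {u v w x : H} (hu : (u, w) ∈ h.graph)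
    (hv : (v, x) ∈ h.graph) : ⟪w, v⟫_ℂ = ⟪u, x⟫_ℂ := by
  rw [LinearPMap.mem_graph_iff] at hu hv
  obtain ⟨u, rfl, rfl⟩ := hu
  obtain ⟨v, rfl, rfl⟩ := hv
  exact inner_symm hh u v

lemma inner_japInvSq (hh : IsSelfAdjoint h) {f w g x : H} 
    (hf : (w, f - japInvSq hh f) ∈ h.graph)
    (hg : (japInvSq hh g, x) ∈ h.graph) :
    ⟪f, japInvSq hh g⟫_ℂ = ⟪japInvSq hh f, japInvSq hh g⟫_ℂ + ⟪w, x⟫_ℂ := by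
  rw [← graph_symm hh hf hg, inner_sub_left]; ring

lemma isSelfAdjoint_japInvSq (hh : IsSelfAdjoint h) : IsSelfAdjoint (japInvSq hh) := by
  rw [ContinuousLinearMap.isSelfAdjoint_iff_isSymmetric]
  intro f g
  obtain ⟨w, hw, hw'⟩ := japInvSq_spec hh f
  obtain ⟨x, hx, hx'⟩ := japInvSq_spec hh g
  show ⟪japInvSq hh f, g⟫_ℂ = ⟪f, japInvSq hh g⟫_ℂ
  rw [inner_japInvSq hh hw' hx, ← inner_conj_symm, inner_japInvSq hh hx' hw,
    map_add, inner_conj_symm, inner_conj_symm]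

lemma japInvSq_nonneg (hh : IsSelfAdjoint h) : 0 ≤ japInvSq hh := by
  rw [ContinuousLinearMap.nonneg_iff_isPositive]
  refine ⟨(ContinuousLinearMap.isSelfAdjoint_iff_isSymmetric.mp
    (isSelfAdjoint_japInvSq hh)), fun f => ?_⟩
  obtain ⟨w, hw, hw'⟩ := japInvSq_spec hh f
  rw [ContinuousLinearMap.reApplyInnerSelf_apply, ← inner_conj_symm, 
    inner_japInvSq hh hw' hw, inner_self_eq_norm_sq_to_K, inner_self_eq_norm_sq_to_K,
    RCLike.conj_re]
  rw [map_add, ← RCLike.ofReal_pow, ← RCLike.ofReal_pow, RCLike.ofReal_re, RCLike.ofReal_re]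
  positivity

lemma japInvSq_injective (hh : IsSelfAdjoint h) : Function.Injective (japInvSq hh) := by
  rw [injective_iff_map_eq_zero]
  intro f hf
  obtain ⟨w, hw, hw'⟩ := japInvSq_spec hh f
  rw [hf] at hw hw'
  have h0 := h.graph_fst_eq_zero_snd hw rfl
  replace h0 : w = 0 := h0
  subst h0
  simpa using h.graph_fst_eq_zero_snd hw' rfl

/-- The bounded operator `⟨h⟩^{-s} = (1 + h²)^{-s/2}`, `s ≥ 0`, a power of `⟨h⟩⁻²` in the
continuous functional calculus. -/
def japPow (hh : IsSelfAdjoint h) (s : ℝ≥0) : H →L[ℂ] H :=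
  cfc (fun x : ℝ => x ^ ((s : ℝ) / 2)) (japInvSq hh)

lemma japPow_add (hh : IsSelfAdjoint h) (s t : ℝ≥0) :
    japPow hh (s + t) = japPow hh s * japPow hh t := by
  have hc : ∀ r : ℝ≥0, ContinuousOn (fun x : ℝ => x ^ ((r : ℝ) / 2))
      (spectrum ℝ (japInvSq hh)) := fun r =>
    (Real.continuous_rpow_const (by positivity)).continuousOn
  rw [japPow, japPow, japPow, ← cfc_mul _ _ _ (hc s) (hc t)]
  refine cfc_congr fun x hx => ?_
  have hx0 : 0 ≤ x := spectrum_nonneg_of_nonneg (japInvSq_nonneg hh) hx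
  rw [← Real.rpow_add_of_nonneg hx0 (by positivity) (by positivity)]
  push_cast; ring_nf

lemma japPow_zero (hh : IsSelfAdjoint h) : japPow hh 0 = 1 := by
  have := isSelfAdjoint_japInvSq hh
  simp only [japPow, NNReal.coe_zero, zero_div, Real.rpow_zero]
  exact cfc_const_one ℝ _

lemma japPow_two (hh : IsSelfAdjoint h) : japPow hh 2 = japInvSq hh := by
  have := isSelfAdjoint_japInvSq hh
  simp only [japPow, NNReal.coe_ofNat, div_self (two_ne_zero' ℝ), Real.rpow_one]
  exact cfc_id' ℝ _

lemma isSelfAdjoint_japPow (hh : IsSelfAdjoint h) (s : ℝ≥0) : IsSelfAdjoint (japPow hh s) :=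
  cfc_predicate _ _

lemma japPow_injective (hh : IsSelfAdjoint h) (s : ℝ≥0) : Function.Injective (japPow hh s) := by
  have key : ∀ n : ℕ, Function.Injective (japPow hh (2 * n)) := by
    intro n
    induction n with
    | zero =>
      intro a b hab
      simpa [japPow_zero] using hab
    | succ n ih =>
      have : (2 * ((n + 1 : ℕ) : ℝ≥0)) = 2 + 2 * n := by push_cast; ring
      rw [this, japPow_add, japPow_two]
      exact (japInvSq_injective hh).comp ih
  obtain ⟨n, hn⟩ := exists_nat_ge s
  have h2 : 2 * (n : ℝ≥0) = (2 * n - s) + s := by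
    rw [tsub_add_cancel_of_le]; exact hn.trans (by linarith [n.cast_nonneg (α := ℝ≥0)])
  have h3 := key n
  rw [h2, japPow_add] at h3
  intro a b hab
  exact h3 (congrArg (japPow hh (2 * n - s)) hab)


lemma japInvSq_unique (hh : IsSelfAdjoint h) {f c d : H} (h1 : (c, d) ∈ h.graph)
    (h2 : (d, f - c) ∈ h.graph) : japInvSq hh f = c := by
  obtain ⟨w, hw, hw'⟩ := japInvSq_spec hh f
  set a := japInvSq hh f
  have e1 : (a - c, w - d) ∈ h.graph := h.graph.sub_mem hw h1
  have e2 : (w - d, c - a) ∈ h.graph := by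
    have := h.graph.sub_mem hw' h2
    simpa using this
  have e3 := graph_symm hh e1 e1
  have e4 := graph_symm hh e2 e1
  have e5 : ⟪w - d, w - d⟫_ℂ + ⟪a - c, a - c⟫_ℂ = 0 := by
    rw [← e4, ← neg_sub a c, inner_neg_left]; ring
  have e6 := congrArg RCLike.re e5
  rw [map_add, inner_self_eq_norm_sq, inner_self_eq_norm_sq] at e6
  have e7 : ‖a - c‖ = 0 := by
    have := sq_nonneg ‖w - d‖
    have := sq_nonneg ‖a - c‖
    have e8 : ‖a - c‖ ^ 2 = 0 := by
      simp only [map_zero] at e6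
      linarith
    simpa using e8
  exact sub_eq_zero.mp (norm_eq_zero.mp e7)

lemma japInvSq_comm (hh : IsSelfAdjoint h) {u v : H} (huv : (u, v) ∈ h.graph) :
    (japInvSq hh u, japInvSq hh v) ∈ h.graph := by
  obtain ⟨b, hb, hb'⟩ := japInvSq_spec hh u
  have h1 : (u - japInvSq hh u, v - b) ∈ h.graph := h.graph.sub_mem huv hb
  rwa [japInvSq_unique hh hb' h1]

lemma japPow_one_mul (hh : IsSelfAdjoint h) (f : H) :
    japPow hh 1 (japPow hh 1 f) = japInvSq hh f := by
  rw [← japPow_two hh, ← one_add_one_eq_two, japPow_add]; rfl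

lemma norm_japPow_one_apply_le (hh : IsSelfAdjoint h) {u v : H} (huv : (u, v) ∈ h.graph) :
    ‖japPow hh 1 v‖ ≤ ‖u‖ := by
  obtain ⟨b, hb, hb'⟩ := japInvSq_spec hh u
  have hb2 : japInvSq hh v = b := by
    have h1 : (u - japInvSq hh u, v - b) ∈ h.graph := h.graph.sub_mem huv hb
    exact japInvSq_unique hh hb' h1
  have hs := (ContinuousLinearMap.isSelfAdjoint_iff_isSymmetric.mp (isSelfAdjoint_japPow hh 1))
  have e1 : ⟪japPow hh 1 v, japPow hh 1 v⟫_ℂ = ⟪u, u⟫_ℂ - ⟪u, japInvSq hh u⟫_ℂ := by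
    rw [← inner_sub_right, ← graph_symm hh huv hb', ← hb2, ← japPow_one_mul]
    exact hs v (japPow hh 1 v)
  have e2 : ⟪u, japInvSq hh u⟫_ℂ = ⟪japPow hh 1 u, japPow hh 1 u⟫_ℂ := by
    rw [← japPow_one_mul]; exact (hs u (japPow hh 1 u)).symm
  rw [e2] at e1
  have e3 := congrArg RCLike.re e1
  rw [map_sub, inner_self_eq_norm_sq, inner_self_eq_norm_sq, inner_self_eq_norm_sq] at e3
  refine le_of_sq_le_sq ?_ (norm_nonneg u)
  nlinarith [sq_nonneg ‖japPow hh 1 u‖]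

lemma japPow_one_mem_domain (hh : IsSelfAdjoint h) (f : H) : japPow hh 1 f ∈ h.domain := by
  have hs := (ContinuousLinearMap.isSelfAdjoint_iff_isSymmetric.mp (isSelfAdjoint_japPow hh 1))
  have h1 : japPow hh 1 f ∈ h.adjoint.domain := by
    rw [LinearPMap.mem_adjoint_domain_iff]
    refine AddMonoidHomClass.continuous_of_bound _ ‖f‖ fun u => ?_
    have : ((innerₛₗ ℂ (japPow hh 1 f)).comp h.toFun) u = ⟪f, japPow hh 1 (h u)⟫_ℂ := hs f (h u)
    rw [this]
    refine (norm_inner_le_norm _ _).trans ?_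
    gcongr
    exact norm_japPow_one_apply_le hh (h.mem_graph u)
  rwa [(LinearPMap.isSelfAdjoint_def).mp hh] at h1

lemma norm_apply_japPow_one_le (hh : IsSelfAdjoint h) (f : H) :
    ‖h ⟨japPow hh 1 f, japPow_one_mem_domain hh f⟩‖ ≤ ‖f‖ := by
  have hs := (ContinuousLinearMap.isSelfAdjoint_iff_isSymmetric.mp (isSelfAdjoint_japPow hh 1))
  set y := h ⟨japPow hh 1 f, japPow_one_mem_domain hh f⟩ with hy
  have key : ∀ u : H, ‖⟪y, u⟫_ℂ‖ ≤ ‖f‖ * ‖u‖ := by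
    have hcl : IsClosed {u : H | ‖⟪y, u⟫_ℂ‖ ≤ ‖f‖ * ‖u‖} :=
      isClosed_le (by fun_prop) (by fun_prop)
    intro u
    refine hcl.closure_subset_iff.mpr ?_ (hh.dense_domain u)
    intro u hu
    have e : ⟪y, u⟫_ℂ = ⟪f, japPow hh 1 (h ⟨u, hu⟩)⟫_ℂ := by
      rw [hy, inner_symm hh _ ⟨u, hu⟩]; exact hs f _
    show ‖⟪y, u⟫_ℂ‖ ≤ ‖f‖ * ‖u‖
    rw [e]
    refine (norm_inner_le_norm _ _).trans ?_
    gcongr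
    exact norm_japPow_one_apply_le hh (h.mem_graph ⟨u, hu⟩)
  have h2 := key y
  rw [inner_self_eq_norm_sq_to_K] at h2
  simp only [norm_pow, RCLike.norm_ofReal, abs_norm] at h2
  by_contra hc
  push Not at hc
  nlinarith [norm_nonneg f]

/-- The bounded operator `h ⟨h⟩⁻¹`. -/
def hJap (hh : IsSelfAdjoint h) : H →L[ℂ] H :=
  LinearMap.mkContinuous
    { toFun := fun f => h ⟨japPow hh 1 f, japPow_one_mem_domain hh f⟩
      map_add' := fun f g => by rw [← LinearPMap.map_add]; congr 1; ext; simp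
      map_smul' := fun c f => by
        rw [RingHom.id_apply, ← LinearPMap.map_smul]; congr 1; ext; simp }
    1 (fun f => by rw [one_mul]; exact norm_apply_japPow_one_le hh f)

/-- `⟨h⟩^{-s} 𝓗 = Dom |h|^s`, `s ≥ 0`: the range of `⟨h⟩^{-s}`. -/
def Sob (hh : IsSelfAdjoint h) (s : ℝ≥0) : Type _ :=
  LinearMap.range (japPow hh s : H →ₗ[ℂ] H)

namespace Sob

variable {hh : IsSelfAdjoint h} {s t : ℝ≥0}

instance : AddCommGroup (Sob hh s) :=
  inferInstanceAs (AddCommGroup (LinearMap.range (japPow hh s : H →ₗ[ℂ] H)))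

instance : Module ℂ (Sob hh s) :=
  inferInstanceAs (Module ℂ (LinearMap.range (japPow hh s : H →ₗ[ℂ] H)))

instance : CoeOut (Sob hh s) H := ⟨fun u => u.1⟩

variable (hh s) in
/-- The linear bijection `⟨h⟩^{-s} : 𝓗 → ⟨h⟩^{-s} 𝓗`. -/
def ofH : H ≃ₗ[ℂ] Sob hh s :=
  LinearEquiv.ofInjective (japPow hh s : H →ₗ[ℂ] H) (japPow_injective hh s)

/-- The norm is `‖u‖ = ‖⟨h⟩^s u‖`. -/
instance : NormedAddCommGroup (Sob hh s) :=
  NormedAddCommGroup.induced (Sob hh s) H (ofH hh s).symm (ofH hh s).symm.injective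

instance : NormedSpace ℂ (Sob hh s) :=
  NormedSpace.induced ℂ (Sob hh s) H (ofH hh s).symm

variable (hh s) in
/-- The unitary map `⟨h⟩^{-s} : 𝓗 → ⟨h⟩^{-s} 𝓗`. -/
def iso : H ≃ₗᵢ[ℂ] Sob hh s where
  toLinearEquiv := ofH hh s
  norm_map' f := by
    show ‖(ofH hh s).symm (ofH hh s f)‖ = ‖f‖
    rw [LinearEquiv.symm_apply_apply]

lemma coe_iso (f : H) : ((iso hh s f : Sob hh s) : H) = japPow hh s f := rfl

lemma coe_injective : Function.Injective (fun u : Sob hh s => (u : H)) :=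
  Subtype.val_injective

lemma japPow_iso_symm (u : Sob hh s) : japPow hh s ((iso hh s).symm u) = u := by
  rw [← coe_iso, LinearIsometryEquiv.apply_symm_apply]

variable (hh s) in
/-- The embedding `⟨h⟩^{-s} 𝓗 ⊂ 𝓗`. -/
def toH : Sob hh s →L[ℂ] H :=
  (japPow hh s).comp ((iso hh s).symm : Sob hh s →L[ℂ] H)

lemma toH_apply (u : Sob hh s) : toH hh s u = u := japPow_iso_symm u

variable (hh) in
/-- The embedding `⟨h⟩^{-s} 𝓗 ⊂ ⟨h⟩^{-t} 𝓗`, `t ≤ s`; its value at `u` is `u`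
(see `coe_incl`). -/
def incl (_hts : t ≤ s) : Sob hh s →L[ℂ] Sob hh t :=
  ((iso hh t : H →L[ℂ] Sob hh t).comp (japPow hh (s - t))).comp
    ((iso hh s).symm : Sob hh s →L[ℂ] H)

lemma coe_incl (hts : t ≤ s) (u : Sob hh s) : ((incl hh hts u : Sob hh t) : H) = u := by
  show japPow hh t (japPow hh (s - t) ((iso hh s).symm u)) = u
  rw [← japPow_iso_symm u, ← mul_apply_eq_comp, ← japPow_add,
    add_tsub_cancel_of_le hts]

end Sob

/-- The adjoint space `E*`: continuous antilinear functionals on `E`. -/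
abbrev AntiDual (E : Type*) [NormedAddCommGroup E] [NormedSpace ℂ E] := E →L⋆[ℂ] ℂ

/-- The transpose `F* → E*`, `φ ↦ φ ∘ X`, of `X : E → F`. -/
def transpose {E F : Type*} [NormedAddCommGroup E] [NormedSpace ℂ E] [NormedAddCommGroup F]
    [NormedSpace ℂ F] (X : E →L[ℂ] F) : AntiDual F →L[ℂ] AntiDual E :=
  LinearMap.mkContinuous
    { toFun := fun φ => φ.comp X
      map_add' := fun _ _ => rfl
      map_smul' := fun _ _ => rfl }
    ‖X‖ (fun φ => by rw [mul_comm]; exact ContinuousLinearMap.opNorm_comp_le φ X)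

variable (H) in
/-- The Riesz identification `𝓗 = 𝓗*`, `v ↦ (· | v)`. -/
def riesz : H →L[ℂ] AntiDual H := innerSLFlip ℂ

/-- The embedding `𝓗 ⊂ ⟨h⟩^s 𝓗 = (⟨h⟩^{-s} 𝓗)*`, `v ↦ (· | v)`. -/
def toNeg (hh : IsSelfAdjoint h) (s : ℝ≥0) : H →L[ℂ] AntiDual (Sob hh s) :=
  (transpose (Sob.toH hh s)).comp (riesz H)

lemma toNeg_apply (hh : IsSelfAdjoint h) (s : ℝ≥0) (v : H) (u : Sob hh s) :
    toNeg hh s v u = ⟪(u : H), v⟫_ℂ := by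
  rw [← Sob.toH_apply u]; rfl

/-- The embedding `⟨h⟩^t 𝓗 ⊂ ⟨h⟩^s 𝓗`, `t ≤ s`: restriction of functionals to
`⟨h⟩^{-s} 𝓗 ⊂ ⟨h⟩^{-t} 𝓗`. -/
def inclNeg (hh : IsSelfAdjoint h) {s t : ℝ≥0} (hts : t ≤ s) :
    AntiDual (Sob hh t) →L[ℂ] AntiDual (Sob hh s) :=
  transpose (Sob.incl hh hts)

/-- The continuous extension `h : ⟨h⟩^{-1/2} 𝓗 → ⟨h⟩^{1/2} 𝓗` of `h : Dom h → 𝓗`: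
`(v | h u) = (⟨h⟩^{1/2} v | h ⟨h⟩⁻¹ ⟨h⟩^{1/2} u)`. It agrees with `h` on `Dom h = ⟨h⟩⁻¹ 𝓗`
(see `hExt_apply_of_mem_domain`), which is dense in `⟨h⟩^{-1/2} 𝓗` (see `Sob.denseRange_incl`). -/
def hExt (hh : IsSelfAdjoint h) : Sob hh (1 / 2) →L[ℂ] AntiDual (Sob hh (1 / 2)) :=
  (((transpose ((Sob.iso hh (1 / 2)).symm : Sob hh (1 / 2) →L[ℂ] H)).comp (riesz H)).comp
    (hJap hh)).comp ((Sob.iso hh (1 / 2)).symm : Sob hh (1 / 2) →L[ℂ] H)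


lemma hJap_graph (hh : IsSelfAdjoint h) (f : H) : (japPow hh 1 f, hJap hh f) ∈ h.graph :=
  h.mem_graph ⟨japPow hh 1 f, japPow_one_mem_domain hh f⟩

lemma hJap_comm_japPow (hh : IsSelfAdjoint h) (s : ℝ≥0) (f : H) :
    hJap hh (japPow hh s f) = japPow hh s (hJap hh f) := by
  have hc : Commute (japInvSq hh) (hJap hh) := by
    ext f
    have h1 := japInvSq_comm hh (hJap_graph hh f)
    have h2 := hJap_graph hh (japInvSq hh f)
    have h3 : japInvSq hh (japPow hh 1 f) = japPow hh 1 (japInvSq hh f) := by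
      rw [← japPow_one_mul, ← japPow_one_mul]
    rw [h3] at h1
    exact h.mem_graph_snd_inj' h1 h2 rfl
  have hsa := isSelfAdjoint_japInvSq hh
  exact (congrArg (fun A : H →L[ℂ] H => A f) (hc.cfc_real _).eq).symm

/-- `Dom h = ⟨h⟩⁻¹ 𝓗`. -/
lemma mem_domain_iff (hh : IsSelfAdjoint h) (u : H) :
    u ∈ h.domain ↔ ∃ f, japPow hh 1 f = u := by
  constructor
  · intro hu
    refine ⟨japPow hh 1 u + hJap hh (h ⟨u, hu⟩), ?_⟩
    have h1 := japInvSq_comm hh (h.mem_graph ⟨u, hu⟩)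
    obtain ⟨w, hw, hw'⟩ := japInvSq_spec hh u
    have h2 : japInvSq hh (h ⟨u, hu⟩) = w := h.mem_graph_snd_inj' h1 hw rfl
    have h3 := hJap_graph hh (japPow hh 1 (h ⟨u, hu⟩))
    rw [japPow_one_mul, h2] at h3
    have h4 := h.mem_graph_snd_inj' h3 hw' rfl
    rw [map_add, japPow_one_mul, ← hJap_comm_japPow]
    simp only at h4
    rw [h4]; abel
  · rintro ⟨f, rfl⟩
    exact japPow_one_mem_domain hh f

lemma hExt_apply_of_mem_domain (hh : IsSelfAdjoint h) (u : Sob hh (1 / 2))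
    (hu : (u : H) ∈ h.domain) : hExt hh u = toNeg hh (1 / 2) (h ⟨u, hu⟩) := by
  obtain ⟨f, hf⟩ := (mem_domain_iff hh _).mp hu
  have h1 : h ⟨u, hu⟩ = hJap hh f :=
    h.mem_graph_snd_inj' (h.mem_graph ⟨u, hu⟩) (hJap_graph hh f) hf.symm
  have h2 : (Sob.iso hh (1 / 2)).symm u = japPow hh (1 / 2) f := by
    apply japPow_injective hh (1 / 2)
    rw [Sob.japPow_iso_symm, ← hf, ← mul_apply_eq_comp, ← japPow_add, add_halves]
  ext v
  rw [toNeg_apply, h1, ← Sob.japPow_iso_symm v]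
  show ⟪(Sob.iso hh (1 / 2)).symm v, hJap hh ((Sob.iso hh (1 / 2)).symm u)⟫_ℂ = _
  rw [h2, hJap_comm_japPow]
  exact ((ContinuousLinearMap.isSelfAdjoint_iff_isSymmetric.mp
    (isSelfAdjoint_japPow hh (1 / 2))) _ _).symm

lemma denseRange_japPow (hh : IsSelfAdjoint h) (s : ℝ≥0) : DenseRange (japPow hh s) := by
  have : (LinearMap.range (japPow hh s : H →ₗ[ℂ] H)).topologicalClosure = ⊤ := by
    rw [Submodule.topologicalClosure_eq_top_iff, Submodule.eq_bot_iff]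
    intro v hv
    apply japPow_injective hh s
    rw [map_zero, ← inner_self_eq_zero (𝕜 := ℂ)]
    rw [← hv _ ⟨japPow hh s v, rfl⟩]
    exact ((ContinuousLinearMap.isSelfAdjoint_iff_isSymmetric.mp
      (isSelfAdjoint_japPow hh s)) _ _).symm
  exact (Submodule.dense_iff_topologicalClosure_eq_top (s := LinearMap.range _)).mpr this

lemma Sob.incl_injective (hh : IsSelfAdjoint h) {s t : ℝ≥0} (hts : t ≤ s) :
    Function.Injective (Sob.incl hh hts) := by
  intro u v huv
  apply Sob.coe_injective
  show (u : H) = v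
  rw [← Sob.coe_incl hts u, huv, Sob.coe_incl]

lemma Sob.denseRange_incl (hh : IsSelfAdjoint h) {s t : ℝ≥0} (hts : t ≤ s) :
    DenseRange (Sob.incl hh hts) :=
  ((Sob.iso hh t).surjective.denseRange.comp (denseRange_japPow hh (s - t))
    (Sob.iso hh t).continuous).comp (Sob.iso hh s).symm.surjective.denseRange
    (((Sob.iso hh t).continuous).comp (japPow hh (s - t)).continuous)

lemma toNeg_injective (hh : IsSelfAdjoint h) (s : ℝ≥0) : Function.Injective (toNeg hh s) := by
  rw [injective_iff_map_eq_zero]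
  intro v hv
  apply japPow_injective hh s
  rw [map_zero, ← inner_self_eq_zero (𝕜 := ℂ)]
  have h1 := toNeg_apply hh s v (Sob.iso hh s (japPow hh s v))
  rw [hv, Sob.coe_iso] at h1
  refine Eq.trans ?_ h1.symm
  exact ((ContinuousLinearMap.isSelfAdjoint_iff_isSymmetric.mp
      (isSelfAdjoint_japPow hh s)) _ _).symm

lemma inclNeg_injective (hh : IsSelfAdjoint h) {s t : ℝ≥0} (hts : t ≤ s) :
    Function.Injective (inclNeg hh hts) := by
  intro φ ψ hφ
  apply ContinuousLinearMap.coeFn_injective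
  refine (Sob.denseRange_incl hh hts).equalizer φ.continuous ψ.continuous ?_
  funext u
  exact congrArg (fun χ : AntiDual (Sob hh s) => χ u) hφ

/-- The unique continuous extension `k : 𝓗 → ⟨h⟩^{1/2} 𝓗` of a symmetric
`k : ⟨h⟩^{-1/2} 𝓗 → 𝓗` (see `kExt_coe`): `k v = (k · | v)`. -/
def kExt (hh : IsSelfAdjoint h) (k : Sob hh (1 / 2) →L[ℂ] H) :
    H →L[ℂ] AntiDual (Sob hh (1 / 2)) :=
  (transpose k).comp (riesz H)

lemma kExt_coe (hh : IsSelfAdjoint h) (k : Sob hh (1 / 2) →L[ℂ] H)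
    (hk : ∀ u v : Sob hh (1 / 2), ⟪k u, (v : H)⟫_ℂ = ⟪(u : H), k v⟫_ℂ) (u : Sob hh (1 / 2)) :
    kExt hh k u = toNeg hh (1 / 2) (k u) := by
  ext v
  rw [toNeg_apply]
  exact hk v u

/-- `h₀ = h + k² : ⟨h⟩^{-1/2} 𝓗 → ⟨h⟩^{1/2} 𝓗`. -/
def hZero (hh : IsSelfAdjoint h) (k : Sob hh (1 / 2) →L[ℂ] H) :
    Sob hh (1 / 2) →L[ℂ] AntiDual (Sob hh (1 / 2)) :=
  hExt hh + (kExt hh k).comp k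

/-- The quadratic pencil `p(z) = h + z (2 k - z) : ⟨h⟩^{-1/2} 𝓗 → ⟨h⟩^{1/2} 𝓗`. -/
def pencil (hh : IsSelfAdjoint h) (k : Sob hh (1 / 2) →L[ℂ] H) (z : ℂ) :
    Sob hh (1 / 2) →L[ℂ] AntiDual (Sob hh (1 / 2)) :=
  hExt hh + (toNeg hh (1 / 2)).comp (z • ((2 : ℂ) • k - z • Sob.toH hh (1 / 2)))

/-- The resolvent set `ρ(h, k)` of the pencil. -/
def pencilResolventSet (hh : IsSelfAdjoint h) (k : Sob hh (1 / 2) →L[ℂ] H) : Set ℂ :=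
  {z | Function.Bijective (pencil hh k z)}

/-- `𝓔 = ⟨h⟩^{-1/2} 𝓗 ⊕ 𝓗`. -/
abbrev EnergySpace (hh : IsSelfAdjoint h) : Type _ := Sob hh (1 / 2) × H

/-- `𝓔* = 𝓗 ⊕ ⟨h⟩^{1/2} 𝓗`. -/
abbrev EnergyDual (hh : IsSelfAdjoint h) : Type _ := H × AntiDual (Sob hh (1 / 2))

/-- `𝓚_θ = ⟨h⟩^{-θ} 𝓗 ⊕ ⟨h⟩^θ 𝓗`. -/
abbrev ChargeSpace (hh : IsSelfAdjoint h) (θ : ℝ≥0) : Type _ :=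
  Sob hh θ × AntiDual (Sob hh θ)

/-- The embedding `𝓔 ⊂ 𝓚_θ`. -/
def energyToCharge (hh : IsSelfAdjoint h) {θ : ℝ≥0} (hθ : θ ≤ 1 / 2) :
    EnergySpace hh →L[ℂ] ChargeSpace hh θ :=
  (Sob.incl hh hθ).prodMap (toNeg hh θ)

/-- The embedding `𝓚_θ ⊂ 𝓔*`. -/
def chargeToDual (hh : IsSelfAdjoint h) {θ : ℝ≥0} (hθ : θ ≤ 1 / 2) :
    ChargeSpace hh θ →L[ℂ] EnergyDual hh :=
  (Sob.toH hh θ).prodMap (inclNeg hh hθ)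

lemma energyToCharge_injective (hh : IsSelfAdjoint h) {θ : ℝ≥0} (hθ : θ ≤ 1 / 2) :
    Function.Injective (energyToCharge hh hθ) :=
  (Sob.incl_injective hh hθ).prodMap (toNeg_injective hh θ)

lemma chargeToDual_injective (hh : IsSelfAdjoint h) {θ : ℝ≥0} (hθ : θ ≤ 1 / 2) :
    Function.Injective (chargeToDual hh hθ) := by
  have h1 : Function.Injective (Sob.toH hh θ) := by
    intro u v huv
    apply Sob.coe_injective
    show (u : H) = v
    rw [← Sob.toH_apply u, huv, Sob.toH_apply]
  exact h1.prodMap (inclNeg_injective hh hθ)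

/-- The Klein-Gordon operator `K̂ (u₀, u₁) = (k u₀ + u₁, h₀ u₀ + k u₁)`, `𝓔 → 𝓔*`. -/
def hatK (hh : IsSelfAdjoint h) (k : Sob hh (1 / 2) →L[ℂ] H) :
    EnergySpace hh →L[ℂ] EnergyDual hh :=
  (k.comp (ContinuousLinearMap.fst ℂ _ _) + ContinuousLinearMap.snd ℂ _ _).prod
    ((hZero hh k).comp (ContinuousLinearMap.fst ℂ _ _) +
      (kExt hh k).comp (ContinuousLinearMap.snd ℂ _ _))

section Induced

variable {X Y Z : Type*} [NormedAddCommGroup X] [NormedSpace ℂ X] [NormedAddCommGroup Y]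
  [NormedSpace ℂ Y] [NormedAddCommGroup Z] [NormedSpace ℂ Z]

/-- The operator induced in `Y` by `S : X → Z`, where `X ⊂ Y ⊂ Z` through the injections
`i : X → Y` and `j : Y → Z`: the restriction of `S` to `{u ∈ X | S u ∈ Y}`. -/
def inducedOperator (i : X →L[ℂ] Y) (j : Y →L[ℂ] Z) (S : X →L[ℂ] Z) : Y →ₗ.[ℂ] Y :=
  Submodule.toLinearPMap
    { carrier := {p | ∃ u : X, i u = p.1 ∧ S u = j p.2}
      zero_mem' := ⟨0, by simp⟩
      add_mem' := by
        rintro p q ⟨u, hu, hu'⟩ ⟨v, hv, hv'⟩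
        exact ⟨u + v, by simp [hu, hv], by simp [hu', hv']⟩
      smul_mem' := by
        rintro c p ⟨u, hu, hu'⟩
        exact ⟨c • u, by simp [hu], by simp [hu']⟩ }

lemma mem_inducedOperator_graph {i : X →L[ℂ] Y} {j : Y →L[ℂ] Z} (S : X →L[ℂ] Z)
    (hi : Function.Injective i) (hj : Function.Injective j) (p : Y × Y) :
    p ∈ (inducedOperator i j S).graph ↔ ∃ u : X, i u = p.1 ∧ S u = j p.2 := by
  rw [inducedOperator, Submodule.toLinearPMap_graph_eq]
  · rfl
  · rintro ⟨x, y⟩ ⟨u, hu, hu'⟩ (rfl : x = 0)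
    have : u = 0 := hi (by simpa using hu)
    apply hj
    rw [← hu', this, map_zero, map_zero]

/-- The resolvent set of an operator in a normed space. -/
def opResolventSet (T : Y →ₗ.[ℂ] Y) : Set ℂ :=
  {z | ∃ R : Y →L[ℂ] Y, (∀ y, ∃ hy : R y ∈ T.domain, T ⟨R y, hy⟩ - z • R y = y) ∧
    ∀ u : T.domain, R (T u - z • (u : Y)) = u}

/-- `Y` is a Krein space for the form `B` (antilinear in the first argument). -/
structure IsKreinSpace (B : Y →ₗ⋆[ℂ] Y →ₗ[ℂ] ℂ) : Prop where
  complete : CompleteSpace Y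
  /-- Some scalar product defines the topology of `Y`. -/
  hilbertizable : ∃ (c : InnerProductSpace.Core ℂ Y) (C : ℝ), ∀ u,
    ‖u‖ ^ 2 ≤ C * (c.inner u u).re ∧ (c.inner u u).re ≤ C * ‖u‖ ^ 2
  hermitian : ∀ u v, B u v = conj (B v u)
  continuous : ∃ C : ℝ, ∀ u v, ‖B u v‖ ≤ C * ‖u‖ * ‖v‖
  representation : ∀ φ : Y →L[ℂ] ℂ, ∃! u, ∀ v, φ v = B u v

/-- `T` is densely defined and `T = T*`, the adjoint being taken with respect to `B`. -/
def IsKreinSelfAdjoint (B : Y →ₗ⋆[ℂ] Y →ₗ[ℂ] ℂ) (T : Y →ₗ.[ℂ] Y) : Prop :=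
  Dense (T.domain : Set Y) ∧
    ∀ v w : Y, (v, w) ∈ T.graph ↔ ∀ u : T.domain, B (T u) v = B u w

end Induced

/-- The charge `⟨u|v⟩ = (u₀|v₁) + (u₁|v₀)` on `𝓚_θ`, with `(u|φ) = φ(u)` and
`(φ|u) = conj (u|φ)` for `u ∈ ⟨h⟩^{-θ} 𝓗`, `φ ∈ ⟨h⟩^θ 𝓗`. -/
def charge (hh : IsSelfAdjoint h) (θ : ℝ≥0) :
    ChargeSpace hh θ →ₗ⋆[ℂ] ChargeSpace hh θ →ₗ[ℂ] ℂ :=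
  LinearMap.mk₂'ₛₗ (starRingEnd ℂ) (RingHom.id ℂ) (fun u v => v.2 u.1 + conj (u.2 v.1))
    (fun u u' v => by simp; ring) (fun c u v => by simp; ring)
    (fun u v v' => by simp; ring) (fun c u v => by simp; ring)

/-- The charge Klein-Gordon operator `K_θ`, induced by `K̂` in `𝓚_θ`. -/
def chargeKG (hh : IsSelfAdjoint h) (k : Sob hh (1 / 2) →L[ℂ] H) {θ : ℝ≥0} (hθ : θ ≤ 1 / 2) :
    ChargeSpace hh θ →ₗ.[ℂ] ChargeSpace hh θ :=
  inducedOperator (energyToCharge hh hθ) (chargeToDual hh hθ) (hatK hh k)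

end KleinGordon

end

open KleinGordon

noncomputable section

/-! Everything reduces to the bounded operator `K̂ - z : 𝓔 → 𝓔*`. Eliminating the second component
by `u₁ = f₀ - (k - z) u₀` turns `(K̂ - z) u = f` into `p(z) u₀ = f₁ - (k - z) f₀`, because `h + k² -
(k - z)² = p(z)` (`hatK_sub_eq_iff`). Hence `K̂ - z` is bijective exactly when `p(z)` is, and its
inverse `Q : 𝓔* → 𝓔` is then bounded. Sandwiched between the dense embeddings `𝓚_θ ⊂ 𝓔*` and `𝓔 ⊂
𝓚_θ`, `Q` is the resolvent of `K_θ`. Conversely, a resolvent of `K_θ` at `z` is lifted to `𝓔*` with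
the help of one point `z₀ ∈ ρ(h, k)`, by the first resolvent identity.

The unitaries `⟨h⟩^{∓θ}` turn the charge into `(f₀|g₁) + (f₁|g₀)` on `𝓗 ⊕ 𝓗`, whence the Krein
property. For selfadjointness, `K_θ` is symmetric (`chargeKG_symm`), and `ρ(h, k)` is invariant
under conjugation since `p(z̄)` is the adjoint of `p(z)`. So `K_θ - z` and `K_θ - z̄` are both onto
for some `z`, which leaves no room for a proper extension of `K_θ` inside its adjoint. Density of
the domain comes from that of the embeddings. The description of the domain is the definition of the
induced operator in components. -/

namespace KleinGordon

variable {H : Type*} [NormedAddCommGroup H] [InnerProductSpace ℂ H] [CompleteSpace H]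
  {h : H →ₗ.[ℂ] H}

/-! ### Duality and density in the scale `⟨h⟩^s 𝓗`. -/

/-- The Riesz representation of a continuous antilinear functional. -/
lemma exists_inner_eq {E : Type*} [NormedAddCommGroup E] [InnerProductSpace ℂ E]
    [CompleteSpace E] (φ : AntiDual E) : ∃ v : E, ∀ u, φ u = ⟪u, v⟫_ℂ := by
  let ψ : E →L[ℂ] ℂ := ((starL ℂ : ℂ ≃L⋆[ℂ] ℂ) : ℂ →L⋆[ℂ] ℂ).comp φ
  refine ⟨(InnerProductSpace.toDual ℂ E).symm ψ, fun u => ?_⟩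
  rw [← inner_conj_symm, InnerProductSpace.toDual_symm_apply]
  exact (star_star (φ u)).symm

/-- The map `⟨h⟩^s : 𝓗 → ⟨h⟩^s 𝓗`, `v ↦ (⟨h⟩^s · | v)`. -/
def negMap (hh : IsSelfAdjoint h) (s : ℝ≥0) : H →L[ℂ] AntiDual (Sob hh s) :=
  (transpose ((Sob.iso hh s).symm : Sob hh s →L[ℂ] H)).comp (riesz H)

lemma negMap_apply (hh : IsSelfAdjoint h) (s : ℝ≥0) (v : H) (u : Sob hh s) :
    negMap hh s v u = ⟪(Sob.iso hh s).symm u, v⟫_ℂ := rfl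

lemma norm_negMap (hh : IsSelfAdjoint h) (s : ℝ≥0) (v : H) : ‖negMap hh s v‖ = ‖v‖ := by
  apply le_antisymm
  · refine ContinuousLinearMap.opNorm_le_bound _ (norm_nonneg v) fun u => ?_
    rw [negMap_apply, mul_comm]
    refine (norm_inner_le_norm _ _).trans_eq ?_
    rw [LinearIsometryEquiv.norm_map]
  -- The test vector `⟨h⟩^{-s} v` has norm `‖v‖` and is paired to `‖v‖²`.
  · have h1 := (negMap hh s v).le_opNorm (Sob.iso hh s v)
    rw [negMap_apply, LinearIsometryEquiv.symm_apply_apply, LinearIsometryEquiv.norm_map,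
      inner_self_eq_norm_sq_to_K, norm_pow, RCLike.norm_ofReal, abs_norm] at h1
    by_contra hc
    push Not at hc
    nlinarith [norm_nonneg (negMap hh s v)]

lemma negMap_surjective (hh : IsSelfAdjoint h) (s : ℝ≥0) :
    Function.Surjective (negMap hh s) := by
  intro φ
  obtain ⟨v, hv⟩ := exists_inner_eq
    (φ.comp ((Sob.iso hh s : H ≃ₗᵢ[ℂ] Sob hh s) : H →L[ℂ] Sob hh s))
  refine ⟨v, ?_⟩
  ext u
  rw [negMap_apply, ← hv]
  exact congrArg φ (LinearIsometryEquiv.apply_symm_apply (Sob.iso hh s) u)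

/-- The unitary map `⟨h⟩^s : 𝓗 → ⟨h⟩^s 𝓗`. -/
def negIso (hh : IsSelfAdjoint h) (s : ℝ≥0) : H ≃ₗᵢ[ℂ] AntiDual (Sob hh s) :=
  LinearIsometryEquiv.ofSurjective
    { toLinearMap := (negMap hh s : H →ₗ[ℂ] AntiDual (Sob hh s))
      norm_map' := norm_negMap hh s } (negMap_surjective hh s)

lemma negIso_apply (hh : IsSelfAdjoint h) (s : ℝ≥0) (v : H) (u : Sob hh s) :
    negIso hh s v u = ⟪(Sob.iso hh s).symm u, v⟫_ℂ := rfl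

instance (hh : IsSelfAdjoint h) (s : ℝ≥0) : CompleteSpace (Sob hh s) :=
  (Sob.iso hh s).toIsometryEquiv.completeSpace_iff.mp inferInstance

/-- Selfadjointness of `⟨h⟩^{-s}`. Up to a unitary the embedding is `⟨h⟩^{-s}` itself, so it
inherits the dense range. -/
lemma toNeg_eq_negIso_japPow (hh : IsSelfAdjoint h) (s : ℝ≥0) (v : H) :
    toNeg hh s v = negIso hh s (japPow hh s v) := by
  ext u
  rw [toNeg_apply, negIso_apply, ← Sob.japPow_iso_symm u]
  exact (ContinuousLinearMap.isSelfAdjoint_iff_isSymmetric.mp (isSelfAdjoint_japPow hh s)) _ _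

lemma denseRange_toNeg (hh : IsSelfAdjoint h) (s : ℝ≥0) : DenseRange (toNeg hh s) := by
  have h1 : (toNeg hh s : H → AntiDual (Sob hh s)) = negIso hh s ∘ japPow hh s :=
    funext (toNeg_eq_negIso_japPow hh s)
  rw [h1]
  exact (negIso hh s).surjective.denseRange.comp (denseRange_japPow hh s)
    (negIso hh s).continuous

lemma inclNeg_toNeg (hh : IsSelfAdjoint h) {s t : ℝ≥0} (hts : t ≤ s) (v : H) :
    inclNeg hh hts (toNeg hh t v) = toNeg hh s v := by
  ext u
  rw [toNeg_apply]
  refine (toNeg_apply hh t v (Sob.incl hh hts u)).trans ?_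
  rw [Sob.coe_incl]

lemma denseRange_inclNeg (hh : IsSelfAdjoint h) {s t : ℝ≥0} (hts : t ≤ s) :
    DenseRange (inclNeg hh hts) := by
  refine (denseRange_toNeg hh s).mono ?_
  rintro _ ⟨v, rfl⟩
  exact ⟨toNeg hh t v, inclNeg_toNeg hh hts v⟩

lemma denseRange_toH (hh : IsSelfAdjoint h) (s : ℝ≥0) : DenseRange (Sob.toH hh s) :=
  (denseRange_japPow hh s).comp (Sob.iso hh s).symm.surjective.denseRange
    (japPow hh s).continuous

lemma denseRange_energyToCharge (hh : IsSelfAdjoint h) {θ : ℝ≥0} (hθ : θ ≤ 1 / 2) :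
    DenseRange (energyToCharge hh hθ) :=
  (Sob.denseRange_incl hh hθ).prodMap (denseRange_toNeg hh θ)

lemma denseRange_chargeToDual (hh : IsSelfAdjoint h) {θ : ℝ≥0} (hθ : θ ≤ 1 / 2) :
    DenseRange (chargeToDual hh hθ) :=
  (denseRange_toH hh θ).prodMap (denseRange_inclNeg hh hθ)

/-- The embedding `𝓔 ⊂ 𝓔*`. -/
def energyToDual (hh : IsSelfAdjoint h) : EnergySpace hh →L[ℂ] EnergyDual hh :=
  (Sob.toH hh (1 / 2)).prodMap (toNeg hh (1 / 2))

lemma chargeToDual_energyToCharge (hh : IsSelfAdjoint h) {θ : ℝ≥0} (hθ : θ ≤ 1 / 2)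
    (u : EnergySpace hh) :
    chargeToDual hh hθ (energyToCharge hh hθ u) = energyToDual hh u := by
  refine Prod.ext ?_ (inclNeg_toNeg hh hθ u.2)
  show Sob.toH hh θ (Sob.incl hh hθ u.1) = Sob.toH hh (1 / 2) u.1
  rw [Sob.toH_apply, Sob.toH_apply, Sob.coe_incl]

/-! ### Symmetry of the extended `h` and conjugation of the pencil. -/

/-- The bounded operator `h ⟨h⟩⁻¹` is symmetric: this follows from the symmetry of `h` when one
argument lies in the dense range of `⟨h⟩⁻¹`, and extends by continuity. -/
lemma hExt_symm (hh : IsSelfAdjoint h) (u v : Sob hh (1 / 2)) :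
    hExt hh u v = conj (hExt hh v u) := by
  have key : ∀ f g : H, ⟪f, hJap hh g⟫_ℂ = ⟪hJap hh f, g⟫_ℂ := by
    have key1 : ∀ f g : H, ⟪japPow hh 1 f, hJap hh g⟫_ℂ = ⟪hJap hh (japPow hh 1 f), g⟫_ℂ := by
      intro f g
      rw [hJap_comm_japPow, ← graph_symm hh (hJap_graph hh f) (hJap_graph hh g)]
      exact ((ContinuousLinearMap.isSelfAdjoint_iff_isSymmetric.mp
        (isSelfAdjoint_japPow hh 1)) _ _).symm
    intro f g
    have hl : Continuous fun f => ⟪f, hJap hh g⟫_ℂ := by fun_prop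
    have hr : Continuous fun f => ⟪hJap hh f, g⟫_ℂ := by fun_prop
    exact congrFun ((denseRange_japPow hh 1).equalizer hl hr (funext fun f => key1 f g)) f
  show ⟪(Sob.iso hh (1 / 2)).symm v, hJap hh ((Sob.iso hh (1 / 2)).symm u)⟫_ℂ
    = conj ⟪(Sob.iso hh (1 / 2)).symm u, hJap hh ((Sob.iso hh (1 / 2)).symm v)⟫_ℂ
  rw [key, inner_conj_symm]

lemma pencil_apply (hh : IsSelfAdjoint h) (k : Sob hh (1 / 2) →L[ℂ] H) (z : ℂ)
    (u v : Sob hh (1 / 2)) :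
    pencil hh k z u v = hExt hh u v + z * (2 * ⟪(v : H), k u⟫_ℂ - z * ⟪(v : H), (u : H)⟫_ℂ) := by
  have : pencil hh k z u v
      = hExt hh u v + toNeg hh (1 / 2) (z • ((2 : ℂ) • k u - z • Sob.toH hh (1 / 2) u)) v := rfl
  rw [this, toNeg_apply, inner_smul_right, inner_sub_right, inner_smul_right, inner_smul_right,
    Sob.toH_apply]

lemma pencil_conj (hh : IsSelfAdjoint h) (k : Sob hh (1 / 2) →L[ℂ] H)
    (hk : ∀ u v : Sob hh (1 / 2), ⟪k u, (v : H)⟫_ℂ = ⟪(u : H), k v⟫_ℂ) (z : ℂ)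
    (u v : Sob hh (1 / 2)) : pencil hh k (conj z) u v = conj (pencil hh k z v u) := by
  rw [pencil_apply, pencil_apply, hExt_symm hh u v]
  simp only [map_add, map_mul, map_sub, inner_conj_symm, map_ofNat]
  rw [hk]

/-- Transported to a bounded operator `P` on `𝓗` by the two unitaries, the pencil satisfies `P(z̄) =
P(z)*`, and the adjoint of an invertible operator is invertible. -/
lemma conj_mem_pencilResolventSet (hh : IsSelfAdjoint h) (k : Sob hh (1 / 2) →L[ℂ] H)
    (hk : ∀ u v : Sob hh (1 / 2), ⟪k u, (v : H)⟫_ℂ = ⟪(u : H), k v⟫_ℂ) {z : ℂ}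
    (hz : z ∈ pencilResolventSet hh k) : conj z ∈ pencilResolventSet hh k := by
  let P : ℂ → H →L[ℂ] H := fun w =>
    (((negIso hh (1 / 2)).symm : AntiDual (Sob hh (1 / 2)) →L[ℂ] H).comp (pencil hh k w)).comp
      ((Sob.iso hh (1 / 2)) : H →L[ℂ] Sob hh (1 / 2))
  have hP : ∀ w, (P w : H → H)
      = (negIso hh (1 / 2)).symm ∘ pencil hh k w ∘ Sob.iso hh (1 / 2) := fun w => rfl
  have hbij : ∀ w, Function.Bijective (P w) ↔ w ∈ pencilResolventSet hh k := by
    intro w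
    rw [hP, (negIso hh (1 / 2)).symm.bijective.of_comp_iff',
      Function.Bijective.of_comp_iff _ (Sob.iso hh (1 / 2)).bijective]
    rfl
  have hinner : ∀ w f g, ⟪f, P w g⟫_ℂ
      = pencil hh k w (Sob.iso hh (1 / 2) g) (Sob.iso hh (1 / 2) f) := by
    intro w f g
    have h1 := negIso_apply hh (1 / 2) (P w g) (Sob.iso hh (1 / 2) f)
    rw [LinearIsometryEquiv.symm_apply_apply] at h1
    rw [← h1, hP, Function.comp_apply, LinearIsometryEquiv.apply_symm_apply]
    rfl
  have hadj : P (conj z) = ContinuousLinearMap.adjoint (P z) := by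
    rw [ContinuousLinearMap.eq_adjoint_iff]
    intro f g
    rw [← inner_conj_symm, hinner, hinner, pencil_conj hh k hk, Complex.conj_conj]
  rw [← hbij, ← ContinuousLinearMap.isUnit_iff_bijective] at hz ⊢
  rw [hadj]
  exact hz.star

/-! ### Reduction of `K̂ - z` to the pencil. -/

section Schur

variable (hh : IsSelfAdjoint h) (k : Sob hh (1 / 2) →L[ℂ] H)
  (hk : ∀ u v : Sob hh (1 / 2), ⟪k u, (v : H)⟫_ℂ = ⟪(u : H), k v⟫_ℂ)

include hk in
/-- Elimination of the second component in `(K̂ - z) u = f`. -/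
lemma hatK_sub_eq_iff (z : ℂ) (u : EnergySpace hh) (f : EnergyDual hh) :
    hatK hh k u - z • energyToDual hh u = f ↔
      u.2 = f.1 - (k u.1 - z • (u.1 : H)) ∧
        pencil hh k z u.1 = f.2 - (kExt hh k f.1 - toNeg hh (1 / 2) (z • f.1)) := by
  have h1 : (hatK hh k u - z • energyToDual hh u).1 = k u.1 + u.2 - z • (u.1 : H) := by
    rw [← Sob.toH_apply]; rfl
  have h2 : (hatK hh k u - z • energyToDual hh u).2
      = hExt hh u.1 + kExt hh k (k u.1) + kExt hh k u.2 - z • toNeg hh (1 / 2) u.2 := rfl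
  have h3 : pencil hh k z u.1 = hExt hh u.1
      + z • ((2 : ℂ) • toNeg hh (1 / 2) (k u.1) - z • toNeg hh (1 / 2) (u.1 : H)) := by
    rw [← map_smul (toNeg hh (1 / 2)), ← map_smul (toNeg hh (1 / 2)), ← map_sub,
      ← map_smul (toNeg hh (1 / 2)), ← Sob.toH_apply]; rfl
  -- Symmetry of `k` enters here: on `⟨h⟩^{-1/2} 𝓗` the extended `k` agrees with `k`, so the terms
  -- `k²u₀` cancel and the two terms `z k u₀` add up.
  have h4 := kExt_coe hh k hk u.1
  rw [Prod.ext_iff, h1, h2]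
  have e1 : k u.1 + u.2 - z • (u.1 : H) = f.1 ↔ u.2 = f.1 - (k u.1 - z • (u.1 : H)) := by
    constructor
    · intro e; rw [← e]; abel
    · intro e; rw [e]; abel
  rw [e1]
  refine and_congr_right fun e => ?_
  rw [e, h3]
  simp only [map_sub, map_smul, h4, smul_sub]
  rw [← sub_eq_zero, ← sub_eq_zero (b := f.2 - _)]
  refine Eq.congr_left ?_
  module

include hk in
lemma bijective_hatK_sub_iff (z : ℂ) :
    Function.Bijective (hatK hh k - z • energyToDual hh) ↔ z ∈ pencilResolventSet hh k := by
  have hS : ∀ u f, (hatK hh k - z • energyToDual hh) u = f ↔ _ :=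
    hatK_sub_eq_iff hh k hk z
  constructor
  · rintro ⟨hi, hs⟩
    constructor
    · rw [injective_iff_map_eq_zero]
      intro u hu
      -- A kernel vector of `p(z)` lifts to one of `K̂ - z`, with second component `-(k - z) u`.
      have h1 := (hS (u, -(k u - z • (u : H))) 0).mpr ⟨by simp, by simpa using hu⟩
      rw [← map_zero (hatK hh k - z • energyToDual hh)] at h1
      exact congrArg Prod.fst (hi h1)
    · intro g
      -- With `f₀ = 0` the reduced equation is exactly `p(z) u₀ = g`.
      obtain ⟨u, hu⟩ := hs (0, g)
      refine ⟨u.1, ?_⟩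
      simpa using ((hS u (0, g)).mp hu).2
  · rintro ⟨hi, hs⟩
    constructor
    · rw [injective_iff_map_eq_zero]
      intro u hu
      obtain ⟨h1, h2⟩ := (hS u 0).mp hu
      have h3 : u.1 = 0 := hi (by simpa using h2)
      refine Prod.ext h3 ?_
      rw [h1, ← Sob.toH_apply, h3]
      simp
    · intro f
      obtain ⟨u, hu⟩ := hs (f.2 - (kExt hh k f.1 - toNeg hh (1 / 2) (z • f.1)))
      exact ⟨(u, f.1 - (k u - z • (u : H))), (hS _ f).mpr ⟨rfl, hu⟩⟩

end Schur

/-! ### The Krein space `𝓚_θ`. -/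

section Charge

variable (hh : IsSelfAdjoint h) (θ : ℝ≥0)

lemma charge_apply (u v : ChargeSpace hh θ) : charge hh θ u v = v.2 u.1 + conj (u.2 v.1) := rfl

lemma charge_symm (u v : ChargeSpace hh θ) : charge hh θ u v = conj (charge hh θ v u) := by
  simp only [charge_apply, map_add, Complex.conj_conj]; ring

/-- Nondegeneracy: the Riesz dual of `u₀` in the second slot detects `u₀`, and vectors `(x, 0)`
detect the functional `u₁`. -/
lemma eq_zero_of_charge_eq_zero (u : ChargeSpace hh θ) (hu : ∀ v, charge hh θ u v = 0) :
    u = 0 := by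
  refine Prod.ext ?_ ?_
  · have h1 := hu (0, negIso hh θ ((Sob.iso hh θ).symm u.1))
    rw [charge_apply, negIso_apply] at h1
    simpa using h1
  · ext x
    have h1 := hu (x, 0)
    rw [charge_apply] at h1
    simpa using h1

lemma norm_charge_le (u v : ChargeSpace hh θ) : ‖charge hh θ u v‖ ≤ 2 * ‖u‖ * ‖v‖ := by
  have h1 : ‖v.2 u.1‖ ≤ ‖v‖ * ‖u‖ := (v.2.le_opNorm u.1).trans
    (mul_le_mul (norm_snd_le v) (norm_fst_le u) (norm_nonneg _) (norm_nonneg _))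
  have h2 : ‖u.2 v.1‖ ≤ ‖u‖ * ‖v‖ := (u.2.le_opNorm v.1).trans
    (mul_le_mul (norm_snd_le u) (norm_fst_le v) (norm_nonneg _) (norm_nonneg _))
  rw [charge_apply]
  refine (norm_add_le _ _).trans ?_
  rw [RCLike.norm_conj]
  linarith [mul_comm ‖u‖ ‖v‖]

/-- The scalar product of `𝓚_θ`. -/
@[reducible] def chargeCore : InnerProductSpace.Core ℂ (ChargeSpace hh θ) where
  inner u v := ⟪(Sob.iso hh θ).symm u.1, (Sob.iso hh θ).symm v.1⟫_ℂ +
    ⟪(negIso hh θ).symm u.2, (negIso hh θ).symm v.2⟫_ℂ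
  conj_inner_symm u v := by simp only [map_add, inner_conj_symm]
  re_inner_nonneg u := by
    rw [map_add]; exact add_nonneg inner_self_nonneg inner_self_nonneg
  add_left u v w := by
    simp only [Prod.fst_add, Prod.snd_add, map_add, inner_add_left]; ring
  smul_left u v c := by
    simp only [Prod.smul_fst, Prod.smul_snd, map_smul, inner_smul_left]; ring
  definite u hu := by
    have h1 := congrArg RCLike.re hu
    rw [map_add, inner_self_eq_norm_sq, inner_self_eq_norm_sq, LinearIsometryEquiv.norm_map,
      LinearIsometryEquiv.norm_map, map_zero] at h1
    have h2 := sq_nonneg ‖u.1‖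
    have h3 := sq_nonneg ‖u.2‖
    refine Prod.ext ?_ ?_
    · have : ‖u.1‖ ^ 2 = 0 := by linarith
      simpa using this
    · have : ‖u.2‖ ^ 2 = 0 := by linarith
      simpa using this

lemma re_chargeCore_inner_self (u : ChargeSpace hh θ) :
    ((chargeCore hh θ).inner u u).re = ‖u.1‖ ^ 2 + ‖u.2‖ ^ 2 := by
  show RCLike.re (⟪(Sob.iso hh θ).symm u.1, (Sob.iso hh θ).symm u.1⟫_ℂ +
    ⟪(negIso hh θ).symm u.2, (negIso hh θ).symm u.2⟫_ℂ) = _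
  rw [map_add, inner_self_eq_norm_sq, inner_self_eq_norm_sq, LinearIsometryEquiv.norm_map,
    LinearIsometryEquiv.norm_map]

lemma exists_charge_eq (φ : ChargeSpace hh θ →L[ℂ] ℂ) : ∃ u, ∀ v, φ v = charge hh θ u v := by
  let a : H →L[ℂ] ℂ := (φ.comp (ContinuousLinearMap.inr ℂ _ _)).comp
    (negIso hh θ : H →L[ℂ] AntiDual (Sob hh θ))
  let b : AntiDual (Sob hh θ) := ((starL ℂ : ℂ ≃L⋆[ℂ] ℂ) : ℂ →L⋆[ℂ] ℂ).comp
    (φ.comp (ContinuousLinearMap.inl ℂ _ _))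
  -- The charge pairs crosswise: `u₀` represents the part of `φ` on `⟨h⟩^θ 𝓗` (Riesz in `𝓗`), while
  -- `u₁` is the conjugate of its part on `⟨h⟩^{-θ} 𝓗`.
  refine ⟨(Sob.iso hh θ ((InnerProductSpace.toDual ℂ H).symm a), b), fun v => ?_⟩
  obtain ⟨v₀, v₁⟩ := v
  obtain ⟨g, rfl⟩ := (negIso hh θ).surjective v₁
  rw [charge_apply, negIso_apply]
  simp only [LinearIsometryEquiv.symm_apply_apply, InnerProductSpace.toDual_symm_apply]
  have hb : conj (b v₀) = φ (v₀, 0) := star_star _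
  have ha : a g = φ (0, negIso hh θ g) := rfl
  rw [ha, hb, ← map_add]
  simp

theorem isKreinSpace_charge : IsKreinSpace (charge hh θ) where
  complete := inferInstance
  hilbertizable := by
    -- The product carries the sup norm, and `max(a, b)² ≤ a² + b² ≤ 2 max(a, b)²`.
    refine ⟨chargeCore hh θ, 2, fun u => ?_⟩
    rw [re_chargeCore_inner_self]
    have h1 := norm_fst_le u
    have h2 := norm_snd_le u
    have h3 := norm_nonneg u.1
    have h4 := norm_nonneg u.2
    constructor
    · rcases max_cases ‖u.1‖ ‖u.2‖ with ⟨e, -⟩ | ⟨e, -⟩ <;>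
        rw [Prod.norm_def, e] <;> nlinarith
    · nlinarith
  hermitian := charge_symm hh θ
  continuous := ⟨2, norm_charge_le hh θ⟩
  representation φ := by
    obtain ⟨u, hu⟩ := exists_charge_eq hh θ φ
    refine ⟨u, hu, fun u' hu' => ?_⟩
    rw [← sub_eq_zero]
    refine eq_zero_of_charge_eq_zero hh θ _ fun v => ?_
    rw [map_sub, LinearMap.sub_apply, ← hu, ← hu', sub_self]

end Charge

/-! ### The operator `K_θ`: domain and symmetry. -/

section Operator

variable (hh : IsSelfAdjoint h) (k : Sob hh (1 / 2) →L[ℂ] H) {θ : ℝ≥0} (hθ : θ ≤ 1 / 2)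

lemma mem_graph_chargeKG (p : ChargeSpace hh θ × ChargeSpace hh θ) :
    p ∈ (chargeKG hh k hθ).graph ↔
      ∃ u, energyToCharge hh hθ u = p.1 ∧ hatK hh k u = chargeToDual hh hθ p.2 :=
  mem_inducedOperator_graph _ (energyToCharge_injective hh hθ) (chargeToDual_injective hh hθ) p

lemma mem_domain_chargeKG (x : ChargeSpace hh θ) :
    x ∈ (chargeKG hh k hθ).domain ↔
      ∃ u, energyToCharge hh hθ u = x ∧ ∃ y, hatK hh k u = chargeToDual hh hθ y := by
  rw [LinearPMap.mem_domain_iff]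
  simp only [mem_graph_chargeKG]
  exact ⟨fun ⟨y, u, h1, h2⟩ => ⟨u, h1, y, h2⟩, fun ⟨u, h1, y, h2⟩ => ⟨y, u, h1, h2⟩⟩

lemma mem_domain_chargeKG_iff_components (x : ChargeSpace hh θ) :
    x ∈ (chargeKG hh k hθ).domain ↔
      ∃ (u₀ : Sob hh (1 / 2)) (u₁ : H),
        (x.1 : H) = u₀ ∧ x.2 = toNeg hh θ u₁ ∧
        (∃ v₀ : Sob hh θ, k u₀ + u₁ = v₀) ∧
        (∃ v₁ : AntiDual (Sob hh θ), hZero hh k u₀ + kExt hh k u₁ = inclNeg hh hθ v₁) := by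
  rw [mem_domain_chargeKG]
  constructor
  · rintro ⟨u, rfl, y, hy⟩
    refine ⟨u.1, u.2, Sob.coe_incl hθ u.1, rfl, ⟨y.1, ?_⟩, y.2, congrArg Prod.snd hy⟩
    rw [← Sob.toH_apply]
    exact congrArg Prod.fst hy
  · rintro ⟨u₀, u₁, h1, h2, ⟨v₀, h3⟩, v₁, h4⟩
    refine ⟨(u₀, u₁), Prod.ext (Sob.coe_injective ?_) h2.symm, (v₀, v₁), Prod.ext ?_ h4⟩
    · exact (Sob.coe_incl hθ u₀).trans h1.symm
    · rw [← Sob.toH_apply] at h3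
      exact h3

lemma chargeKG_symm {u x v y : ChargeSpace hh θ} (hu : (u, x) ∈ (chargeKG hh k hθ).graph)
    (hv : (v, y) ∈ (chargeKG hh k hθ).graph) : charge hh θ x v = charge hh θ u y := by
  -- The charge of `K̂ a` against `b` in terms of `a, b ∈ 𝓔` alone; exchanging `a` and `b`
  -- conjugates the expression.
  have key : ∀ {u x v y : ChargeSpace hh θ} (a b : EnergySpace hh),
      energyToCharge hh hθ b = v → hatK hh k a = chargeToDual hh hθ x →
      charge hh θ x v = ⟪k a.1 + a.2, b.2⟫_ℂ
        + conj (hExt hh a.1 b.1 + ⟪k b.1, k a.1⟫_ℂ + ⟪k b.1, a.2⟫_ℂ) := by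
    intro u x v y a b hb ha
    have e1 : k a.1 + a.2 = (x.1 : H) := by
      rw [← Sob.toH_apply]; exact congrArg Prod.fst ha
    have e2 : hExt hh a.1 b.1 + ⟪k b.1, k a.1⟫_ℂ + ⟪k b.1, a.2⟫_ℂ = x.2 (Sob.incl hh hθ b.1) :=
      congrArg (fun φ : AntiDual (Sob hh (1 / 2)) => φ b.1) (congrArg Prod.snd ha)
    rw [charge_apply, e1, e2, ← hb, ← toNeg_apply]
    rfl
  obtain ⟨a, ha, ha'⟩ := (mem_graph_chargeKG hh k hθ _).mp hu
  obtain ⟨b, hb, hb'⟩ := (mem_graph_chargeKG hh k hθ _).mp hv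
  rw [charge_symm hh θ u y, key (u := u) (y := y) a b hb ha', key (u := u) (y := y) b a ha hb',
    hExt_symm hh b.1 a.1]
  simp only [map_add, inner_conj_symm, Complex.conj_conj, inner_add_left]
  ring

/-! ### Resolvent, selfadjointness and spectrum of `K_θ`. -/

variable (hk : ∀ u v : Sob hh (1 / 2), ⟪k u, (v : H)⟫_ℂ = ⟪(u : H), k v⟫_ℂ)

include hk in
/-- The bounded inverse of `K̂ - z : 𝓔 → 𝓔*`. -/
lemma exists_hatK_inverse {z : ℂ} (hz : z ∈ pencilResolventSet hh k) :
    ∃ Q : EnergyDual hh ≃L[ℂ] EnergySpace hh,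
      ∀ f, hatK hh k (Q f) = f + z • energyToDual hh (Q f) := by
  have hb := (bijective_hatK_sub_iff hh k hk z).mpr hz
  -- The open mapping theorem between the Banach spaces `𝓔` and `𝓔*` makes the inverse bounded.
  let e := ContinuousLinearEquiv.ofBijective (hatK hh k - z • energyToDual hh)
    (LinearMap.ker_eq_bot.mpr hb.1) (LinearMap.range_eq_top.mpr hb.2)
  refine ⟨e.symm, fun f => ?_⟩
  rw [← sub_eq_iff_eq_add]
  exact e.apply_symm_apply f

lemma mem_graph_of_hatK_eq {z : ℂ} {u : EnergySpace hh} {y : ChargeSpace hh θ}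
    (hu : hatK hh k u = chargeToDual hh hθ y + z • energyToDual hh u) :
    (energyToCharge hh hθ u, y + z • energyToCharge hh hθ u) ∈ (chargeKG hh k hθ).graph := by
  rw [mem_graph_chargeKG]
  refine ⟨u, rfl, ?_⟩
  rw [hu, map_add, map_smul, chargeToDual_energyToCharge]

include hk in
lemma exists_mem_graph {z : ℂ} (hz : z ∈ pencilResolventSet hh k) (y : ChargeSpace hh θ) :
    ∃ v, (v, y + z • v) ∈ (chargeKG hh k hθ).graph := by
  obtain ⟨Q, hQ⟩ := exists_hatK_inverse hh k hk hz
  exact ⟨_, mem_graph_of_hatK_eq hh k hθ (hQ (chargeToDual hh hθ y))⟩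

include hk in
lemma dense_domain_chargeKG (hA2 : (pencilResolventSet hh k).Nonempty) :
    Dense ((chargeKG hh k hθ).domain : Set (ChargeSpace hh θ)) := by
  obtain ⟨z, hz⟩ := hA2
  obtain ⟨Q, hQ⟩ := exists_hatK_inverse hh k hk hz
  -- The domain contains the range of the resolvent, a composition of continuous maps with dense
  -- range.
  have hd : DenseRange (energyToCharge hh hθ ∘ Q ∘ chargeToDual hh hθ) :=
    (denseRange_energyToCharge hh hθ).comp (Q.surjective.denseRange.comp
      (denseRange_chargeToDual hh hθ) Q.continuous) (energyToCharge hh hθ).continuous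
  refine hd.mono ?_
  rintro _ ⟨y, rfl⟩
  exact LinearPMap.mem_domain_of_mem_graph
    (mem_graph_of_hatK_eq hh k hθ (hQ (chargeToDual hh hθ y)))

include hk in
theorem isKreinSelfAdjoint_chargeKG (hA2 : (pencilResolventSet hh k).Nonempty) :
    IsKreinSelfAdjoint (charge hh θ) (chargeKG hh k hθ) := by
  refine ⟨dense_domain_chargeKG hh k hθ hk hA2, fun v w => ⟨fun hvw u => ?_, fun hvw => ?_⟩⟩
  · exact chargeKG_symm hh k hθ ((chargeKG hh k hθ).mem_graph u) hvw
  · obtain ⟨z, hz⟩ := hA2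
    -- Take `v'` in the domain with `(K_θ - z̄) v' = w - z̄ v`. For `y = (K_θ - z) u`, which is
    -- arbitrary, `⟨y|v'⟩ = ⟨u|w - z̄ v⟩ = ⟨y|v⟩`, so `v' = v` by nondegeneracy.
    obtain ⟨v', hv'⟩ := exists_mem_graph hh k hθ hk (conj_mem_pencilResolventSet hh k hk hz)
      (w - conj z • v)
    suffices hvv : v' = v by
      rw [hvv, sub_add_cancel] at hv'
      exact hv'
    rw [← sub_eq_zero]
    refine eq_zero_of_charge_eq_zero hh θ _ fun y => ?_
    obtain ⟨u, hu⟩ := exists_mem_graph hh k hθ hk hz y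
    have h1 := chargeKG_symm hh k hθ hu hv'
    have h2 : charge hh θ (y + z • u) v = charge hh θ u w := by
      obtain ⟨u', rfl, hu'⟩ := (LinearPMap.mem_graph_iff _).mp hu
      simp only at hu'
      rw [← hu']
      exact hvw u'
    rw [charge_symm]
    simp only [map_add, map_sub, map_smul, map_smulₛₗ, LinearMap.add_apply,
      LinearMap.smul_apply, smul_eq_mul] at h1 h2 ⊢
    have h3 : charge hh θ y v' = charge hh θ y v := by linear_combination h1 - h2
    rw [h3, sub_self]

include hk in
theorem opResolventSet_chargeKG (hA2 : (pencilResolventSet hh k).Nonempty) :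
    opResolventSet (chargeKG hh k hθ) = pencilResolventSet hh k := by
  ext z
  constructor
  · rintro ⟨R, hR, hR'⟩
    obtain ⟨z₀, hz₀⟩ := hA2
    obtain ⟨Q, hQ⟩ := exists_hatK_inverse hh k hk hz₀
    rw [← bijective_hatK_sub_iff hh k hk]
    constructor
    · rw [injective_iff_map_eq_zero]
      intro u hu
      have h1 : hatK hh k u = chargeToDual hh hθ 0 + z • energyToDual hh u := by
        rw [map_zero, zero_add]; exact sub_eq_zero.mp hu
      have h2 := mem_graph_of_hatK_eq hh k hθ h1
      rw [zero_add] at h2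
      obtain ⟨v, hv, hv'⟩ := (LinearPMap.mem_graph_iff _).mp h2
      have h3 := hR' v
      simp only at hv hv'
      rw [hv', hv, sub_self, map_zero] at h3
      exact energyToCharge_injective hh hθ (by rw [← h3, map_zero])
    · intro f
      obtain ⟨hy, hy'⟩ := hR (energyToCharge hh hθ (Q f))
      obtain ⟨b, hb, hb'⟩ := (mem_graph_chargeKG hh k hθ _).mp
        ((chargeKG hh k hθ).mem_graph ⟨_, hy⟩)
      simp only at hb hb'
      rw [sub_eq_iff_eq_add.mp hy', ← hb, map_add, map_smul, chargeToDual_energyToCharge,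
        chargeToDual_energyToCharge] at hb'
      -- Here `b ∈ 𝓔` satisfies `(K̂ - z) b = Q f`, while `(K̂ - z) Q f = f + (z₀ - z) Q f`; the
      -- correction by `b` cancels the error term.
      refine ⟨Q f + (z - z₀) • b, ?_⟩
      rw [sub_apply, smul_apply, map_add, map_add,
        map_smul, map_smul, hQ, hb']
      module
  · intro hz
    obtain ⟨Q, hQ⟩ := exists_hatK_inverse hh k hk hz
    have hg := fun y => mem_graph_of_hatK_eq hh k hθ (hQ (chargeToDual hh hθ y))
    refine ⟨(energyToCharge hh hθ).comp ((Q : EnergyDual hh →L[ℂ] EnergySpace hh).comp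
      (chargeToDual hh hθ)), fun y => ?_, fun u => ?_⟩
    · obtain ⟨v, hv, hv'⟩ := (LinearPMap.mem_graph_iff _).mp (hg y)
      simp only at hv hv'
      refine ⟨LinearPMap.mem_domain_of_mem_graph (hg y), ?_⟩
      have hv2 : v = ⟨energyToCharge hh hθ (Q (chargeToDual hh hθ y)),
        LinearPMap.mem_domain_of_mem_graph (hg y)⟩ := Subtype.ext hv
      rw [hv2] at hv'
      exact (congrArg (· - _) hv').trans (add_sub_cancel_right _ _)
    · obtain ⟨a, ha, ha'⟩ := (mem_graph_chargeKG hh k hθ _).mp ((chargeKG hh k hθ).mem_graph u)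
      simp only at ha ha'
      show energyToCharge hh hθ (Q (chargeToDual hh hθ (chargeKG hh k hθ u - z • (u : _)))) = u
      rw [map_sub, map_smul, ← ha', ← ha, chargeToDual_energyToCharge]
      congr 1
      apply ((bijective_hatK_sub_iff hh k hk z).mpr hz).1
      exact (sub_eq_iff_eq_add.mpr (hQ _))

end Operator

end KleinGordon

end

theorem mainTheorem8 {H : Type*} [NormedAddCommGroup H] [InnerProductSpace ℂ H]
    [CompleteSpace H] (h : H →ₗ.[ℂ] H) (hh : IsSelfAdjoint h)
    (k : Sob hh (1 / 2) →L[ℂ] H)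
    (hk : ∀ u v : Sob hh (1 / 2), ⟪k u, (v : H)⟫_ℂ = ⟪(u : H), k v⟫_ℂ)
    (hA2 : (pencilResolventSet hh k).Nonempty) (θ : ℝ≥0) (hθ : θ ≤ 1 / 2) :
    (∀ x : ChargeSpace hh θ, x ∈ (chargeKG hh k hθ).domain ↔
      ∃ (u₀ : Sob hh (1 / 2)) (u₁ : H),
        (x.1 : H) = u₀ ∧ x.2 = toNeg hh θ u₁ ∧
        (∃ v₀ : Sob hh θ, k u₀ + u₁ = v₀) ∧
        (∃ v₁ : AntiDual (Sob hh θ), hZero hh k u₀ + kExt hh k u₁ = inclNeg hh hθ v₁)) ∧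
    IsKreinSpace (charge hh θ) ∧
    IsKreinSelfAdjoint (charge hh θ) (chargeKG hh k hθ) ∧
    opResolventSet (chargeKG hh k hθ) = pencilResolventSet hh k := by
  exact ⟨mem_domain_chargeKG_iff_components hh k hθ, isKreinSpace_charge hh θ,
    isKreinSelfAdjoint_chargeKG hh k hθ hk hA2, opResolventSet_chargeKG hh k hθ hk hA2⟩
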